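/- All tournaments are finite. For a set $A$ of vertices of a tournament $G$, let $\chi(A)$ be the least $k$ such that $A$ is the union of $k$ sets each inducing an acyclic subtournament of $G$. For disjoint $A,B\subseteq V(G)$, write $A\Rightarrow B$ if there is no edge with tail in $B$ and head in $A$. A *diamond* in $G$ is a quadruple $(a,b,P,Q)$ where $a,b\in V(G)$ are distinct and $P,Q$ are disjoint subsets of $V(G)\setminus\{a,b\}$ with $\{a\}\Rightarrow P\Rightarrow \{b\}\Rightarrow Q\Rightarrow \{a\}$; its *chromatic number* is $\min(\chi(P),\chi(Q))$. The *local chromatic number* of a numbering $v_1,\ldots,v_n$ of $V(G)$ is the maximum over $1\le i\le n$ of $\chi(X_i)$ (and $0$ if $n=0$), where $X_i$ is the set of all $v_j$ such that either $j<i$ and there is an edge from $v_i$ to $v_j$, or $j>i$ and there is an edge from $v_j$ to $v_i$. Let $c\ge 0$ be an integer. If a tournament $G$ admits a numbering with local chromatic number at most $c$, then $G$ contains no diamond with chromatic number more than $2c$. Conversely, for every integer $c\ge 0$ there exists an integer $d\ge 0$ such that every tournament $G$ that contains no diamond with chromatic number more than $c$ admits a numbering with local chromatic number at most $d$. -/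

import Mathlib

universe u

/-- A tournament with vertex set `V`: a loopless digraph in which each pair of distinct vertices
is joined by exactly one directed edge. `G.Adj u v` means that there is an edge from `u` to `v`,
that is, `v` is adjacent from `u`. -/
structure Tournament (V : Type u) extends Digraph V where
  loopless : ∀ v, ¬ Adj v v
  exactly_one : ∀ u v, u ≠ v → (Adj u v ↔ ¬ Adj v u)

namespace Tournament

variable {V : Type u}

/-- The subtournament induced on `X` is acyclic: it has no directed cycle (there is no nontrivial
closed directed walk all of whose vertices are in `X`). -/
def AcyclicOn (G : Tournament V) (X : Set V) : Prop :=
  ∀ v, ¬ Relation.TransGen (fun x y => x ∈ X ∧ y ∈ X ∧ G.Adj x y) v v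

/-- The chromatic number of the subtournament induced on `A`: the least `k` such that `A` is the
union of `k` sets that each induce an acyclic subtournament. -/
noncomputable def chromaticNumber (G : Tournament V) (A : Set V) : ℕ :=
  sInf {k : ℕ | ∃ X : Fin k → Set V, (⋃ i, X i) = A ∧ ∀ i, G.AcyclicOn (X i)}

/-- `A` is complete to `B`: the sets are disjoint, and no edge has tail in `B` and head in `A`. -/
def CompleteTo (G : Tournament V) (A B : Set V) : Prop :=
  Disjoint A B ∧ ∀ x ∈ B, ∀ y ∈ A, ¬ G.Adj x y

/-- A diamond in `G`: a quadruple `(a, b, P, Q)` where `a ≠ b`, and `P`, `Q` are disjoint sets of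
vertices different from `a` and `b`, such that `a ⇒ P ⇒ b ⇒ Q ⇒ a`. -/
structure Diamond (G : Tournament V) where
  a : V
  b : V
  P : Set V
  Q : Set V
  a_ne_b : a ≠ b
  P_subset : P ⊆ {a, b}ᶜ
  Q_subset : Q ⊆ {a, b}ᶜ
  disjoint : Disjoint P Q
  a_P : G.CompleteTo {a} P
  P_b : G.CompleteTo P {b}
  b_Q : G.CompleteTo {b} Q
  Q_a : G.CompleteTo Q {a}

/-- The chromatic number of a diamond `(a, b, P, Q)` is the minimum of those of `P` and `Q`. -/
noncomputable def Diamond.chromaticNumber {G : Tournament V} (D : G.Diamond) : ℕ :=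
  min (G.chromaticNumber D.P) (G.chromaticNumber D.Q)

/-- A numbering of a finite set `V`: an enumeration of its elements, each exactly once. -/
abbrev Numbering (V : Type u) : Type u := Fin (Nat.card V) ≃ V

/-- The forward in-neighbours of the `i`-th vertex. -/
def forwardInNeighbours (G : Tournament V) (σ : Numbering V) (i : Fin (Nat.card V)) : Set V :=
  {w | ∃ j, w = σ j ∧ i < j ∧ G.Adj (σ j) (σ i)}

/-- The backward out-neighbours of the `i`-th vertex. -/
def backwardOutNeighbours (G : Tournament V) (σ : Numbering V) (i : Fin (Nat.card V)) : Set V :=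
  {w | ∃ j, w = σ j ∧ j < i ∧ G.Adj (σ i) (σ j)}

/-- The local chromatic number of a numbering: the maximum, over all vertices, of the chromatic
number of the set of the backward out-neighbours and forward in-neighbours of that vertex
(and `0` if there are no vertices). -/
noncomputable def localChromaticNumber (G : Tournament V) (σ : Numbering V) : ℕ :=
  Finset.univ.sup fun i =>
    G.chromaticNumber (G.backwardOutNeighbours σ i ∪ G.forwardInNeighbours σ i)

end Tournament

namespace Tournament

variable {V : Type u}

/-! If `a` precedes `b` in a numbering, a vertex `q` with `b → q → a` is a forward in-neighbour of
`a` or a backward out-neighbour of `b`; hence the factor 2. Conversely, without rich diamonds, for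
any two vertices one in-neighbourhood is contained in the other up to boundedly many colours
(`colorable_inDiff_or`). This near-chain yields a numbering in which earlier in-neighbourhoods are
almost contained in later ones. Then, within the backward out-neighbours of a vertex, all
in-neighbourhoods have bounded chromatic number, and dually for forward in-neighbours. The
local-to-global theorem `exists_colorable_of_outNeighbours` and its reverse bound both sets; it
rests on `exists_not_colorable_of_domination`. -/

theorem AcyclicOn.mono {G : Tournament V} {X Y : Set V} (h : X ⊆ Y) (hY : G.AcyclicOn Y) :
    G.AcyclicOn X := fun v hv =>
  hY v (Relation.TransGen.mono (fun _ _ hab => ⟨h hab.1, h hab.2.1, hab.2.2⟩) _ _ hv)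

theorem acyclicOn_singleton (G : Tournament V) (v : V) : G.AcyclicOn {v} := by
  have key : ∀ a b : V, ¬ (a ∈ ({v} : Set V) ∧ b ∈ ({v} : Set V) ∧ G.Adj a b) := by
    rintro a b ⟨rfl, rfl, h⟩
    exact G.loopless _ h
  intro x hx
  obtain ⟨b, -, h⟩ := Relation.TransGen.tail'_iff.1 hx
  exact key _ _ h

/-- An acyclic set contains no cyclic triangle. -/
theorem AcyclicOn.not_triangle {G : Tournament V} {X : Set V} (h : G.AcyclicOn X) {x y z : V}
    (hx : x ∈ X) (hy : y ∈ X) (hz : z ∈ X) (hxy : G.Adj x y) (hyz : G.Adj y z) :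
    ¬ G.Adj z x := fun hzx =>
  h x (((Relation.TransGen.single ⟨hx, hy, hxy⟩).tail ⟨hy, hz, hyz⟩).tail ⟨hz, hx, hzx⟩)

/-- The set `A` is covered by `k` sets that each induce an acyclic subtournament. -/
def Colorable (G : Tournament V) (A : Set V) (k : ℕ) : Prop :=
  ∃ X : Fin k → Set V, A ⊆ (⋃ i, X i) ∧ ∀ i, G.AcyclicOn (X i)

theorem Colorable.mono {G : Tournament V} {A B : Set V} {k : ℕ} (h : A ⊆ B)
    (hB : G.Colorable B k) : G.Colorable A k := by
  obtain ⟨X, hX, hac⟩ := hB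
  exact ⟨X, h.trans hX, hac⟩

theorem Colorable.union {G : Tournament V} {A B : Set V} {k l : ℕ} (hA : G.Colorable A k)
    (hB : G.Colorable B l) : G.Colorable (A ∪ B) (k + l) := by
  obtain ⟨X, hX, hXa⟩ := hA
  obtain ⟨Y, hY, hYa⟩ := hB
  refine ⟨Fin.append X Y, ?_, ?_⟩
  · rintro v (hv | hv)
    · obtain ⟨i, hi⟩ := Set.mem_iUnion.1 (hX hv)
      exact Set.mem_iUnion.2 ⟨Fin.castAdd l i, by rwa [Fin.append_left]⟩
    · obtain ⟨i, hi⟩ := Set.mem_iUnion.1 (hY hv)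
      exact Set.mem_iUnion.2 ⟨Fin.natAdd k i, by rwa [Fin.append_right]⟩
  · intro i
    refine Fin.addCases (fun i => ?_) (fun i => ?_) i
    · rw [Fin.append_left]; exact hXa i
    · rw [Fin.append_right]; exact hYa i

theorem colorable_empty (G : Tournament V) (k : ℕ) : G.Colorable ∅ k :=
  ⟨fun _ => ∅, Set.empty_subset _, fun _ v hv => by
    obtain ⟨_, _, h⟩ := Relation.TransGen.tail'_iff.1 hv
    exact h.1⟩

theorem Colorable.mono_right {G : Tournament V} {A : Set V} {k l : ℕ} (h : k ≤ l)
    (hA : G.Colorable A k) : G.Colorable A l := by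
  obtain ⟨m, rfl⟩ := Nat.exists_eq_add_of_le h
  simpa using hA.union (colorable_empty G m)

theorem colorable_singleton (G : Tournament V) (v : V) : G.Colorable {v} 1 :=
  ⟨fun _ => {v}, fun _ hx => Set.mem_iUnion.2 ⟨0, hx⟩, fun _ => acyclicOn_singleton G v⟩

theorem colorable_biUnion {G : Tournament V} (D : Finset V) (f : V → Set V) {m : ℕ}
    (h : ∀ d ∈ D, G.Colorable (f d) m) : G.Colorable (⋃ d ∈ D, f d) (D.card * m) := by
  classical
  induction D using Finset.induction_on with
  | empty => simpa using colorable_empty G 0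
  | insert a s ha ih =>
    rw [Finset.set_biUnion_insert, Finset.card_insert_of_notMem ha, add_mul, one_mul, add_comm]
    exact (h a (Finset.mem_insert_self a s)).union
      (ih fun d hd => h d (Finset.mem_insert_of_mem hd))

/-- Finiteness makes the set under `sInf` nonempty, so the default value `sInf ∅ = 0` does not
arise; intersecting with `A` turns a cover into an exact union. -/
theorem chromaticNumber_le_iff [Finite V] (G : Tournament V) (A : Set V) (k : ℕ) :
    G.chromaticNumber A ≤ k ↔ G.Colorable A k := by
  classical
  have key : ∀ m, G.Colorable A m →
      m ∈ {k : ℕ | ∃ X : Fin k → Set V, (⋃ i, X i) = A ∧ ∀ i, G.AcyclicOn (X i)} := by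
    rintro m ⟨X, hX, hac⟩
    refine ⟨fun i => X i ∩ A, ?_, fun i => (hac i).mono Set.inter_subset_left⟩
    rw [← Set.iUnion_inter]
    exact Set.inter_eq_right.2 hX
  refine ⟨fun h => ?_, fun h => Nat.sInf_le (key k h)⟩
  have hne : {k : ℕ | ∃ X : Fin k → Set V, (⋃ i, X i) = A ∧ ∀ i, G.AcyclicOn (X i)}.Nonempty := by
    refine ⟨_, key _ ((colorable_biUnion A.toFinite.toFinset (fun v => {v})
      fun d _ => colorable_singleton G d).mono ?_)⟩
    intro v hv
    simpa using hv
  obtain ⟨X, hX, hac⟩ := Nat.sInf_mem hne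
  exact Colorable.mono_right h ⟨X, hX.ge, hac⟩

/-- A cover of a set that is not `k`-colourable by `k + 1` acyclic sets uses each of them. -/
theorem exists_mem_of_not_colorable {G : Tournament V} {A : Set V} {k : ℕ}
    (hA : ¬ G.Colorable A k) {X : Fin (k + 1) → Set V} (hX : A ⊆ ⋃ i, X i)
    (hac : ∀ i, G.AcyclicOn (X i)) (i : Fin (k + 1)) : ∃ a ∈ A, a ∈ X i := by
  by_contra! hcon
  refine hA ⟨fun j => X (i.succAbove j), fun a ha => ?_, fun j => hac _⟩
  obtain ⟨j, hj⟩ := Set.mem_iUnion.1 (hX ha)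
  have hji : j ≠ i := by
    rintro rfl
    exact hcon a ha hj
  obtain ⟨l, rfl⟩ := Fin.exists_succAbove_eq hji
  exact Set.mem_iUnion.2 ⟨l, hj⟩

/-- Every vertex of `Y` belongs to `D` or is adjacent from a vertex of `D`. -/
def Dominates (G : Tournament V) (D Y : Set V) : Prop :=
  ∀ y ∈ Y, y ∈ D ∨ ∃ d ∈ D, G.Adj d y

/-! ### Domination and chromatic number -/

/-- A set with large domination number has a small subset with large chromatic number. -/
theorem exists_not_colorable_of_domination (k : ℕ) : ∃ K l : ℕ, ∀ (V : Type u) [Finite V]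
    (G : Tournament V) (Y : Set V),
    (∀ D : Finset V, (D : Set V) ⊆ Y → D.card < K → ¬ G.Dominates D Y) →
      ∃ A : Finset V, (A : Set V) ⊆ Y ∧ A.card ≤ l ∧ ¬ G.Colorable A k := by
  classical
  induction k with
  | zero =>
    refine ⟨1, 1, fun V _ G Y h => ?_⟩
    have h0 := h ∅ (by simp) (by simp)
    simp only [Dominates, not_forall] at h0
    obtain ⟨y, hy, -⟩ := h0
    refine ⟨{y}, by simpa using hy, by simp, ?_⟩
    rintro ⟨X, hX, -⟩
    obtain ⟨i, -⟩ := Set.mem_iUnion.1 (hX (by simp : y ∈ _))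
    exact i.elim0
  | succ k ih =>
    obtain ⟨K, l, ih⟩ := ih
    -- Chosen so that a set of at most `l` vertices and one of fewer than `K` together have fewer
    -- than `s`.
    set s := l + K with hs
    refine ⟨(k + 1) * s + K, (k + 1) * s + l + ((k + 1) * s).choose s * l,
      fun V _ G Y hY => ?_⟩
    have hexD : ∃ n, ∃ D : Finset V, (D : Set V) ⊆ Y ∧ G.Dominates D Y ∧ D.card = n :=
      ⟨_, Y.toFinite.toFinset, by simp, fun y hy => Or.inl (by simpa using hy), rfl⟩
    obtain ⟨D, hDY, hDdom, hDcard⟩ := Nat.find_spec hexD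
    have hmin : ∀ D' : Finset V, (D' : Set V) ⊆ Y → D'.card < D.card → ¬ G.Dominates D' Y :=
      fun D' h1 h2 h3 => Nat.find_min hexD (hDcard ▸ h2) ⟨D', h1, h3, rfl⟩
    have hDK : (k + 1) * s + K ≤ D.card := by
      by_contra! hlt
      exact hY D hDY hlt hDdom
    obtain ⟨W, hWD, hWcard⟩ := Finset.exists_subset_card_eq (show (k + 1) * s ≤ D.card by omega)
    have hWY : (W : Set V) ⊆ Y := (Finset.coe_subset.2 hWD).trans hDY
    -- Fewer than `K` vertices dominating what `W` misses would, with `W`, dominate `Y` too cheaply.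
    -- The resulting `A` is complete to `W`.
    obtain ⟨A, hAY, hAcard, hAcol⟩ := ih V G {y ∈ Y | y ∉ W ∧ ∀ w ∈ W, ¬ G.Adj w y} (by
      intro D' hD' hcard hdom
      refine hY (W ∪ D') ?_ ?_ ?_
      · rw [Finset.coe_union]
        exact Set.union_subset hWY (hD'.trans fun y hy => hy.1)
      · have := Finset.card_union_le W D'
        omega
      · intro y hy
        by_cases h1 : y ∈ W
        · exact Or.inl (by simp [h1])
        by_cases h2 : ∃ w ∈ W, G.Adj w y
        · obtain ⟨w, hw, hwy⟩ := h2
          exact Or.inr ⟨w, by simp [hw], hwy⟩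
        push Not at h2
        rcases hdom y ⟨hy, h1, h2⟩ with h | ⟨d, hd, hdy⟩
        · exact Or.inl (by simpa using Or.inr h)
        · exact Or.inr ⟨d, by simpa using Or.inr hd, hdy⟩)
    have hAY' : (A : Set V) ⊆ Y := hAY.trans fun y hy => hy.1
    have hAW : ∀ a ∈ A, ∀ w ∈ W, G.Adj a w := by
      intro a ha w hw
      have h := hAY ha
      exact (G.exactly_one a w (by rintro rfl; exact h.2.1 hw)).2 (h.2.2 w hw)
    have hexB : ∀ S ∈ W.powersetCard s, ∃ B : Finset V,
        (B : Set V) ⊆ {y ∈ Y | (y ∈ S ∨ ∃ x ∈ S, G.Adj x y) ∧ y ∉ A ∧ ∀ a ∈ A, ¬ G.Adj a y} ∧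
          B.card ≤ l ∧ ¬ G.Colorable B k := by
      intro S hS
      rw [Finset.mem_powersetCard] at hS
      refine ih V G _ fun D' hD' hcard hdom => ?_
      -- Exchanging `S` for `A ∪ D'` would give a dominating set smaller than the minimum one, `D`.
      refine hmin ((D \ S) ∪ A ∪ D') ?_ ?_ ?_
      · rw [Finset.coe_union, Finset.coe_union]
        refine Set.union_subset (Set.union_subset ?_ hAY') (hD'.trans fun y hy => hy.1)
        exact (Finset.coe_subset.2 Finset.sdiff_subset).trans hDY
      · have h1 := Finset.card_union_le ((D \ S) ∪ A) D'
        have h2 := Finset.card_union_le (D \ S) A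
        have h3 := Finset.card_sdiff_add_card_eq_card (hS.1.trans hWD)
        omega
      · intro y hy
        by_cases h1 : y ∈ A ∨ ∃ a ∈ A, G.Adj a y
        · rcases h1 with h1 | ⟨a, ha, hay⟩
          · exact Or.inl (by simp [h1])
          · exact Or.inr ⟨a, by simp [ha], hay⟩
        push Not at h1
        by_cases h2 : y ∈ S ∨ ∃ x ∈ S, G.Adj x y
        · rcases hdom y ⟨hy, h2, h1.1, h1.2⟩ with h | ⟨d, hd, hdy⟩
          · exact Or.inl (by simpa using Or.inr (Or.inr h))
          · exact Or.inr ⟨d, by simpa using Or.inr (Or.inr hd), hdy⟩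
        push Not at h2
        rcases hDdom y hy with h | ⟨d, hd, hdy⟩
        · have h' : y ∈ D := h
          exact Or.inl (by simp [h', h2.1])
        · have h' : d ∈ D := hd
          have hdS : d ∉ S := fun hdS => h2.2 d hdS hdy
          exact Or.inr ⟨d, by simp [h', hdS], hdy⟩
    choose! B hBsub hBcard hBcol using hexB
    refine ⟨W ∪ A ∪ (W.powersetCard s).biUnion B, ?_, ?_, ?_⟩
    · simp only [Finset.coe_union, Finset.coe_biUnion]
      exact Set.union_subset (Set.union_subset hWY hAY')
        (Set.iUnion₂_subset fun S hS => (hBsub S hS).trans fun y hy => hy.1)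
    · have h1 := Finset.card_union_le (W ∪ A) ((W.powersetCard s).biUnion B)
      have h2 := Finset.card_union_le W A
      have h3 := Finset.card_biUnion_le_card_mul (W.powersetCard s) B l hBcard
      rw [Finset.card_powersetCard, hWcard] at h3
      omega
    · rintro ⟨X, hX, hac⟩
      have hmemX : ∀ w : V, ∃ i, w ∈ W → w ∈ X i := by
        intro w
        by_cases hw : w ∈ W
        · obtain ⟨i, hi⟩ := Set.mem_iUnion.1 (hX (by simp [hw] : w ∈ _))
          exact ⟨i, fun _ => hi⟩
        · exact ⟨0, fun h => absurd h hw⟩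
      choose g hg using hmemX
      -- Some colour contains `s` vertices of `W`, forming `S`. Both `A` and `B S` need all `k + 1`
      -- colours, so this colour contains a cyclic triangle `x → b → a → x` with `x ∈ S`, unless `b
      -- ∈ S`, which is also contradictory.
      obtain ⟨i, -, hi⟩ := Finset.exists_le_card_fiber_of_mul_le_card_of_maps_to
        (s := W) (t := Finset.univ) (f := g) (n := s) (fun _ _ => Finset.mem_univ _)
        Finset.univ_nonempty (by rw [Finset.card_univ, Fintype.card_fin, hWcard])
      obtain ⟨S, hSsub, hScard⟩ := Finset.exists_subset_card_eq hi
      have hSW : S ⊆ W := hSsub.trans (Finset.filter_subset _ _)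
      have hSX : ∀ x ∈ S, x ∈ X i := fun x hx => by
        have hx' := Finset.mem_filter.1 (hSsub hx)
        exact hx'.2 ▸ hg x hx'.1
      have hSmem : S ∈ W.powersetCard s := Finset.mem_powersetCard.2 ⟨hSW, hScard⟩
      obtain ⟨a, haA, haX⟩ := exists_mem_of_not_colorable hAcol
        (X := X) (fun v hv => hX (by simp only [Finset.coe_union]; exact Or.inl (Or.inr hv))) hac i
      obtain ⟨b, hbB, hbX⟩ := exists_mem_of_not_colorable (hBcol S hSmem)
        (X := X) (fun v hv => hX (by
          simp only [Finset.coe_union, Finset.coe_biUnion]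
          exact Or.inr (Set.mem_iUnion₂.2 ⟨S, hSmem, hv⟩))) hac i
      obtain ⟨-, hbS, hbA, hbadj⟩ := hBsub S hSmem hbB
      have haA' : a ∈ A := haA
      have hba : G.Adj b a :=
        (G.exactly_one b a (by rintro rfl; exact hbA haA')).2 (hbadj a haA')
      rcases hbS with hbS | ⟨x, hx, hxb⟩
      · exact hbadj a haA' (hAW a haA' b (hSW hbS))
      · exact (hac i).not_triangle (hSX x hx) hbX haX hxb hba (hAW a haA' x (hSW hx))

/-! ### From local to global chromatic bounds -/

/-- If all out-neighbourhoods in `Y` have bounded chromatic number then so does `Y`. -/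
theorem exists_colorable_of_outNeighbours (c : ℕ) : ∃ d : ℕ, ∀ (V : Type u) [Finite V]
    (G : Tournament V) (Y : Set V),
    (∀ v ∈ Y, G.Colorable {w ∈ Y | G.Adj v w} c) → G.Colorable Y d := by
  obtain ⟨K, l, h⟩ := exists_not_colorable_of_domination.{u} c
  refine ⟨(K + l) * (1 + c), fun V _ G Y hY => ?_⟩
  obtain ⟨D, hDY, hDcard, hD⟩ : ∃ D : Finset V, (D : Set V) ⊆ Y ∧ D.card ≤ K + l ∧
      G.Dominates D Y := by
    by_cases hdom : ∀ D : Finset V, (D : Set V) ⊆ Y → D.card < K → ¬ G.Dominates D Y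
    · obtain ⟨A, hAY, hAcard, hA⟩ := h V G Y hdom
      -- `A` itself dominates: an undominated `y` would have all of `A` among its out-neighbours.
      refine ⟨A, hAY, by omega, fun y hy => ?_⟩
      by_contra! hcon
      refine hA ((hY y hy).mono fun a ha => ?_)
      refine ⟨hAY ha, (G.exactly_one y a (by rintro rfl; exact hcon.1 ha)).2 (hcon.2 a ha)⟩
    · push Not at hdom
      obtain ⟨D, h1, h2, h3⟩ := hdom
      exact ⟨D, h1, by omega, h3⟩
  refine Colorable.mono_right (Nat.mul_le_mul_right _ hDcard) ((colorable_biUnion D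
    (fun d => {d} ∪ {w ∈ Y | G.Adj d w})
    fun d hd => (colorable_singleton G d).union (hY d (hDY hd))).mono ?_)
  intro y hy
  rcases hD y hy with h | ⟨d, hd, hdy⟩
  · exact Set.mem_iUnion₂.2 ⟨y, h, Or.inl rfl⟩
  · exact Set.mem_iUnion₂.2 ⟨d, hd, Or.inr ⟨hy, hdy⟩⟩

/-- The tournament obtained by reversing all edges. -/
def reverse (G : Tournament V) : Tournament V where
  Adj u v := G.Adj v u
  loopless := G.loopless
  exactly_one u v h := G.exactly_one v u h.symm

theorem acyclicOn_reverse {G : Tournament V} {X : Set V} :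
    G.reverse.AcyclicOn X ↔ G.AcyclicOn X := by
  refine forall_congr' fun v => not_congr ?_
  rw [← Relation.transGen_swap]
  have : (Function.swap fun x y => x ∈ X ∧ y ∈ X ∧ G.reverse.Adj x y) =
      fun x y => x ∈ X ∧ y ∈ X ∧ G.Adj x y := by
    funext x y
    exact propext ⟨fun h => ⟨h.2.1, h.1, h.2.2⟩, fun h => ⟨h.2.1, h.1, h.2.2⟩⟩
  rw [this]

theorem colorable_reverse {G : Tournament V} {A : Set V} {k : ℕ} :
    G.reverse.Colorable A k ↔ G.Colorable A k := by
  simp only [Colorable, acyclicOn_reverse]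

/-- If all in-neighbourhoods in `Y` have bounded chromatic number then so does `Y`. -/
theorem exists_colorable_of_inNeighbours (c : ℕ) : ∃ d : ℕ, ∀ (V : Type u) [Finite V]
    (G : Tournament V) (Y : Set V),
    (∀ v ∈ Y, G.Colorable {w ∈ Y | G.Adj w v} c) → G.Colorable Y d := by
  obtain ⟨d, hd⟩ := exists_colorable_of_outNeighbours.{u} c
  exact ⟨d, fun V _ G Y hY => colorable_reverse.1
    (hd V G.reverse Y fun v hv => colorable_reverse.2 (hY v hv))⟩

/-! ### Numbering along the near-chain of in-neighbourhoods -/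

/-- An acyclic relation on a finite type is compatible with some numbering. -/
theorem exists_numbering_of_acyclic [Finite V] (R : V → V → Prop)
    (hR : ∀ v, ¬ Relation.TransGen R v v) :
    ∃ σ : Numbering V, ∀ i j, i < j → ¬ R (σ j) (σ i) := by
  classical
  have := Fintype.ofFinite V
  let r : V → V → Prop := Relation.ReflTransGen R
  have hpo : IsPartialOrder V r :=
    { refl := fun _ => Relation.ReflTransGen.refl
      trans := fun _ _ _ => Relation.ReflTransGen.trans
      antisymm := fun a b hab hba => by
        rcases Relation.reflTransGen_iff_eq_or_transGen.1 hab with h | h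
        · exact h.symm
        · exact absurd (h.trans_left hba) (hR a) }
  obtain ⟨t, ht, hrt⟩ := extend_partialOrder r
  let _ : LinearOrder V :=
    { le := t
      le_refl := ht.refl
      le_trans := ht.trans
      le_antisymm := ht.antisymm
      le_total := ht.total
      toDecidableLE := Classical.decRel _ }
  let e : Fin (Nat.card V) ≃o V := monoEquivOfFin V (Nat.card_eq_fintype_card).symm
  refine ⟨e.toEquiv, fun i j hij hRij => ?_⟩
  have h1 : e j ≤ e i := hrt _ _ (Relation.ReflTransGen.single hRij)
  exact absurd (e.le_iff_le.1 h1) (not_le.2 hij)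

/-- The in-neighbours of `a` that are not in-neighbours of `b`. -/
def inDiff (G : Tournament V) (a b : V) : Set V := {w | G.Adj w a ∧ ¬ G.Adj w b}

theorem inDiff_subset_union (G : Tournament V) (a b x : V) :
    G.inDiff a x ⊆ G.inDiff a b ∪ G.inDiff b x := by
  intro w hw
  by_cases h : G.Adj w b
  · exact Or.inr ⟨h, hw.2⟩
  · exact Or.inl ⟨hw.1, h⟩

/-- The vertices on a directed path of length two from `a` to `b`. -/
def between (G : Tournament V) (a b : V) : Set V := {w | G.Adj a w ∧ G.Adj w b}

/-- The vertex `b` can be an in-neighbour of `a` but never of itself; it costs the extra colour in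
`c + 1`. -/
theorem inDiff_subset (G : Tournament V) (a b : V) :
    G.inDiff a b ⊆ G.between b a ∪ {b} := by
  intro w hw
  by_cases h : w = b
  · exact Or.inr h
  · exact Or.inl ⟨(G.exactly_one b w (Ne.symm h)).2 hw.2, hw.1⟩

theorem not_adj_symm (G : Tournament V) {a b : V} (h : G.Adj a b) : ¬ G.Adj b a := by
  have hne : a ≠ b := by
    rintro rfl
    exact G.loopless _ h
  exact (G.exactly_one a b hne).1 h

/-- The diamond on two vertices that contains all directed paths of length two between them. -/
def fullDiamond (G : Tournament V) (a b : V) (hab : a ≠ b) : G.Diamond where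
  a := a
  b := b
  P := G.between a b
  Q := G.between b a
  a_ne_b := hab
  P_subset := by
    rintro w ⟨h1, h2⟩ (rfl | rfl)
    · exact G.loopless _ h1
    · exact G.loopless _ h2
  Q_subset := by
    rintro w ⟨h1, h2⟩ (rfl | rfl)
    · exact G.loopless _ h2
    · exact G.loopless _ h1
  disjoint := Set.disjoint_left.2 fun _ h1 h2 => G.not_adj_symm h1.1 h2.2
  a_P := ⟨Set.disjoint_singleton_left.2 fun h => G.loopless _ h.1, by
    rintro x hx y rfl
    exact G.not_adj_symm hx.1⟩
  P_b := ⟨Set.disjoint_singleton_right.2 fun h => G.loopless _ h.2, by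
    rintro x rfl y hy
    exact G.not_adj_symm hy.2⟩
  b_Q := ⟨Set.disjoint_singleton_left.2 fun h => G.loopless _ h.1, by
    rintro x hx y rfl
    exact G.not_adj_symm hx.1⟩
  Q_a := ⟨Set.disjoint_singleton_right.2 fun h => G.loopless _ h.2, by
    rintro x rfl y hy
    exact G.not_adj_symm hy.2⟩

theorem colorable_inDiff_or [Finite V] {G : Tournament V} {c : ℕ}
    (hG : ¬ ∃ D : G.Diamond, c < D.chromaticNumber) (a b : V) :
    G.Colorable (G.inDiff a b) (c + 1) ∨ G.Colorable (G.inDiff b a) (c + 1) := by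
  by_cases hab : a = b
  · subst hab
    exact Or.inl ((colorable_empty G _).mono fun w hw => absurd hw.1 hw.2)
  push Not at hG
  have h : min (G.chromaticNumber (G.between a b)) (G.chromaticNumber (G.between b a)) ≤ c :=
    hG (G.fullDiamond a b hab)
  rw [min_le_iff, chromaticNumber_le_iff, chromaticNumber_le_iff] at h
  rcases h with h | h
  · exact Or.inr ((h.union (colorable_singleton G a)).mono (inDiff_subset G b a))
  · exact Or.inl ((h.union (colorable_singleton G b)).mono (inDiff_subset G a b))

/-- If the in-neighbourhoods form a chain up to sets of bounded chromatic number, then the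
vertices can be numbered so that earlier in-neighbourhoods are almost contained in later ones. -/
theorem exists_numbering_of_colorable_inDiff_or [Finite V] {G : Tournament V} {c : ℕ}
    (hG : ∀ a b, G.Colorable (G.inDiff a b) c ∨ G.Colorable (G.inDiff b a) c) :
    ∃ σ : Numbering V, ∀ i j, i < j → G.Colorable (G.inDiff (σ i) (σ j)) (c + c) := by
  obtain ⟨σ, hσ⟩ := exists_numbering_of_acyclic
    (fun a b => ¬ G.Colorable (G.inDiff b a) (c + c)) (by
      -- Two thresholds give transitivity: each step exceeds `c + c`, so if the composite were at
      -- most `c`, adding the `c` for `inDiff a x` would contradict the last step.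
      have key : ∀ a x, Relation.TransGen (fun a b => ¬ G.Colorable (G.inDiff b a) (c + c)) a x →
          ¬ G.Colorable (G.inDiff x a) c := by
        intro a x h
        induction h with
        | single h => exact fun h' => h (h'.mono_right (by omega))
        | @tail x y _ hxy ih =>
          intro hya
          have hax := (hG x a).resolve_left ih
          exact hxy ((hya.union hax).mono (G.inDiff_subset_union y a x))
      exact fun v hv => key v v hv ((colorable_empty G _).mono fun w hw => absurd hw.1 hw.2))
  exact ⟨σ, fun i j hij => not_not.1 (hσ i j hij)⟩

theorem exists_numbering_of_diamond_le (c : ℕ) : ∃ d : ℕ, ∀ (V : Type u) [Finite V]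
    (G : Tournament V), (¬ ∃ D : G.Diamond, c < D.chromaticNumber) →
      ∃ σ : Numbering V, G.localChromaticNumber σ ≤ d := by
  obtain ⟨d₁, h₁⟩ := exists_colorable_of_inNeighbours.{u} (c + 1 + (c + 1))
  obtain ⟨d₂, h₂⟩ := exists_colorable_of_outNeighbours.{u} (c + 1 + (c + 1))
  refine ⟨d₁ + d₂, fun V _ G hG => ?_⟩
  obtain ⟨σ, hσ⟩ := exists_numbering_of_colorable_inDiff_or (colorable_inDiff_or hG)
  refine ⟨σ, Finset.sup_le fun i _ => (chromaticNumber_le_iff _ _ _).2 (Colorable.union ?_ ?_)⟩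
  -- A backward out-neighbour of `σ i` is not an in-neighbour of `σ i`, so the in-neighbours of `σ
  -- j` in this set lie in `inDiff (σ j) (σ i)`.
  · refine h₁ V G _ ?_
    rintro _ ⟨j, rfl, hji, -⟩
    refine (hσ j i hji).mono ?_
    rintro _ ⟨⟨m, rfl, -, hm⟩, hadj⟩
    exact ⟨hadj, G.not_adj_symm hm⟩
  · refine h₂ V G _ ?_
    rintro _ ⟨j, rfl, hij, -⟩
    refine (hσ i j hij).mono ?_
    rintro _ ⟨⟨m, rfl, -, hm⟩, hadj⟩
    exact ⟨hm, G.not_adj_symm hadj⟩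

/-! ### From numberings to diamonds -/

/-- If `σ i` comes before `σ j`, then the paths of length two from `σ j` to `σ i` have their
middle vertices in a set of bounded chromatic number. -/
theorem colorable_of_localChromaticNumber_le [Finite V] {G : Tournament V} {c : ℕ}
    {σ : Numbering V} (hσ : G.localChromaticNumber σ ≤ c) {i j : Fin (Nat.card V)} (hij : i < j)
    {Q : Set V} (hQ : ∀ q ∈ Q, G.Adj (σ j) q ∧ G.Adj q (σ i)) : G.Colorable Q (2 * c) := by
  have h : ∀ i, G.Colorable (G.backwardOutNeighbours σ i ∪ G.forwardInNeighbours σ i) c :=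
    fun i => (chromaticNumber_le_iff _ _ _).1
      ((Finset.le_sup (f := fun i => G.chromaticNumber
        (G.backwardOutNeighbours σ i ∪ G.forwardInNeighbours σ i)) (Finset.mem_univ i)).trans hσ)
  rw [two_mul]
  refine ((h i).union (h j)).mono fun q hq => ?_
  obtain ⟨m, rfl⟩ := σ.surjective q
  by_cases hm : i < m
  · exact Or.inl (Or.inr ⟨m, rfl, hm, (hQ _ hq).2⟩)
  · exact Or.inr (Or.inl ⟨m, rfl, (not_lt.1 hm).trans_lt hij, (hQ _ hq).1⟩)

theorem CompleteTo.adj {G : Tournament V} {A B : Set V} (h : G.CompleteTo A B) {x y : V}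
    (hx : x ∈ A) (hy : y ∈ B) : G.Adj x y :=
  (G.exactly_one x y (fun hxy => Set.disjoint_left.1 h.1 hx (hxy ▸ hy))).2 (h.2 y hy x hx)

theorem Diamond.chromaticNumber_le [Finite V] {G : Tournament V} {c : ℕ} {σ : Numbering V}
    (hσ : G.localChromaticNumber σ ≤ c) (D : G.Diamond) : D.chromaticNumber ≤ 2 * c := by
  have ha : σ (σ.symm D.a) = D.a := σ.apply_symm_apply _
  have hb : σ (σ.symm D.b) = D.b := σ.apply_symm_apply _
  -- The order of `a` and `b` decides which of `Q` and `P` is bounded.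
  rcases lt_or_gt_of_ne (fun h => D.a_ne_b (σ.symm.injective h)) with h | h
  · refine (min_le_right _ _).trans ((chromaticNumber_le_iff _ _ _).2
      (colorable_of_localChromaticNumber_le hσ h fun q hq => ?_))
    rw [ha, hb]
    exact ⟨D.b_Q.adj rfl hq, D.Q_a.adj hq rfl⟩
  · refine (min_le_left _ _).trans ((chromaticNumber_le_iff _ _ _).2
      (colorable_of_localChromaticNumber_le hσ h fun q hq => ?_))
    rw [ha, hb]
    exact ⟨D.a_P.adj rfl hq, D.P_b.adj hq rfl⟩

end Tournament

theorem mainTheorem6 :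
    (∀ (c : ℕ) (V : Type u) [Finite V] (G : Tournament V),
      (∃ σ : Tournament.Numbering V, G.localChromaticNumber σ ≤ c) →
        ¬ ∃ D : G.Diamond, 2 * c < D.chromaticNumber) ∧
    (∀ c : ℕ, ∃ d : ℕ, ∀ (V : Type u) [Finite V] (G : Tournament V),
      (¬ ∃ D : G.Diamond, c < D.chromaticNumber) →
        ∃ σ : Tournament.Numbering V, G.localChromaticNumber σ ≤ d) := by
  refine ⟨?_, Tournament.exists_numbering_of_diamond_le⟩
  rintro c V _ G ⟨σ, hσ⟩ ⟨D, hD⟩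
  exact absurd (D.chromaticNumber_le hσ) (not_le.2 hD)
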